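/- Let $G$ be a metrizable locally compact group with identity $e$. A subset of $G$ is called relatively compact if its closure is compact. A set $T\subseteq G$ is an *E-set* if it is not relatively compact and, for every neighbourhood $U$ of $e$, the set $\bigcap\{t^{-1}Ut : t\in T\cup T^{-1}\}$ is again a neighbourhood of $e$; $G$ is an *E-group* if it contains an E-set. Let $WAP(G)$ be the set of weakly almost periodic functions on $G$, i.e. the bounded continuous $f:G\to\mathbb C$ whose set of left translates $\{f_s : s\in G\}$, $f_s(t)=f(st)$, is relatively compact in the weak topology of the Banach space of bounded continuous functions on $G$ with the supremum norm. A set $T\subseteq G$ is an *approximable $WAP(G)$-interpolation set* if 1. every bounded function $T\to\mathbb C$ extends to a function in $WAP(G)$, and 2. for every neighbourhood $U$ of $e$ there are open neighbourhoods $V_1,V_2$ of $e$ with $\overline{V_1}\subseteq V_2\subseteq U$ such that for each $T_1\subseteq T$ there is $h\in WAP(G)$ with $h=1$ on $V_1T_1$ and $h=0$ on $G\setminus V_2T_1$. For a neighbourhood $V$ of $e$, $T$ is *right $V$-uniformly discrete* if $Vs\cap Vs'=\emptyset$ for all $s\neq s'$ in $T$. A set $S\subseteq G$ is *translation-compact*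 if every subset $L\subseteq G$ that is not relatively compact contains a finite set $F$ such that $\bigcap_{b\in F}b^{-1}S$ is relatively compact, and also contains a finite set $F'$ such that $\bigcap_{b\in F'}Sb^{-1}$ is relatively compact. **Corollary.** Let $G$ be a metrizable locally compact E-group and let $T\subseteq G$ be an E-set. Then $T$ is an approximable $WAP(G)$-interpolation set if and only if there is a neighbourhood $V$ of $e$ such that $T$ is right $V$-uniformly discrete and $VT$ is translation-compact. -/

import Mathlib

open scoped Topology Pointwise BoundedContinuousFunction

section InterpolationSets

variable {G : Type*} [Group G] [TopologicalSpace G]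

/-- `T` is relatively compact in `G`: its closure is compact. -/
def IsRelativelyCompact (T : Set G) : Prop :=
  IsCompact (closure T)

/-- An E-set: a non-relatively compact set `T` such that, for each neighbourhood `U` of the
identity, the intersection of the sets `t⁻¹ U t` over `t ∈ T ∪ T⁻¹` is again a neighbourhood of
the identity. -/
def IsESet (T : Set G) : Prop :=
  ¬ IsRelativelyCompact T ∧
    ∀ U ∈ 𝓝 (1 : G), (⋂ t ∈ T ∪ T⁻¹, {t⁻¹} * U * {t}) ∈ 𝓝 (1 : G)

variable (G) in
/-- An E-group: a group that contains an E-set. -/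
def IsEGroup : Prop :=
  ∃ T : Set G, IsESet T

/-- `T` is right `U`-uniformly discrete: the sets `U s`, `s ∈ T`, are pairwise disjoint. -/
def IsRightUniformlyDiscreteWrt (U T : Set G) : Prop :=
  ∀ s ∈ T, ∀ s' ∈ T, s ≠ s' → (U * {s}) ∩ (U * {s'}) = ∅

/-- Right translation-compact sets: every non-relatively compact `L` contains a finite `F` such
that the intersection of the sets `b⁻¹ T`, `b ∈ F`, is relatively compact. -/
def IsRightTranslationCompact (T : Set G) : Prop :=
  ∀ L : Set G, ¬ IsRelativelyCompact L →
    ∃ F : Set G, F ⊆ L ∧ F.Finite ∧ IsRelativelyCompact (⋂ b ∈ F, {b⁻¹} * T)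

/-- Left translation-compact sets: every non-relatively compact `L` contains a finite `F` such
that the intersection of the sets `T b⁻¹`, `b ∈ F`, is relatively compact. -/
def IsLeftTranslationCompact (T : Set G) : Prop :=
  ∀ L : Set G, ¬ IsRelativelyCompact L →
    ∃ F : Set G, F ⊆ L ∧ F.Finite ∧ IsRelativelyCompact (⋂ b ∈ F, T * {b⁻¹})

/-- Translation-compact: both right and left translation-compact. -/
def IsTranslationCompact (T : Set G) : Prop :=
  IsRightTranslationCompact T ∧ IsLeftTranslationCompact T

/-- `T` is an `A`-interpolation set, for a set `A` of functions on `G`: every bounded function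
`T → ℂ` extends to a function in `A`. -/
def IsInterpolationSet (A : Set (G → ℂ)) (T : Set G) : Prop :=
  ∀ f : T → ℂ, (∃ C : ℝ, ∀ t, ‖f t‖ ≤ C) → ∃ g ∈ A, ∀ t : T, g t = f t

/-- `T` is an approximable `A`-interpolation set. -/
def IsApproximableInterpolationSet (A : Set (G → ℂ)) (T : Set G) : Prop :=
  IsInterpolationSet A T ∧
    ∀ U ∈ 𝓝 (1 : G), ∃ V₁ V₂ : Set G,
      IsOpen V₁ ∧ (1 : G) ∈ V₁ ∧ IsOpen V₂ ∧ (1 : G) ∈ V₂ ∧ closure V₁ ⊆ V₂ ∧ V₂ ⊆ U ∧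
        ∀ T₁ ⊆ T, ∃ h ∈ A, (∀ x ∈ V₁ * T₁, h x = 1) ∧ (∀ x, x ∉ V₂ * T₁ → h x = 0)

/-- The left translate `f_s`, `f_s t = f (s * t)`, as a bounded continuous function. -/
noncomputable def leftTranslate [ContinuousMul G] (s : G) (f : G →ᵇ ℂ) : G →ᵇ ℂ :=
  f.compContinuous ⟨fun t => s * t, continuous_const_mul s⟩

variable (G) in
/-- The weakly almost periodic functions: the bounded continuous functions `f : G → ℂ` whose left
translates form a relatively compact subset of the Banach space of bounded continuous functions
(with the supremum norm) for the weak topology. -/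
def WAP [ContinuousMul G] : Set (G → ℂ) :=
  {f | ∃ F : G →ᵇ ℂ, ⇑F = f ∧
    IsCompact (closure (Set.range fun s : G => toWeakSpace ℂ (G →ᵇ ℂ) (leftTranslate s F)))}

end InterpolationSets

/-! Sufficiency. The sets `V t` are disjoint, so bumps `φ (x t⁻¹) f t` with `φ` supported in `V`
glue to one function `F` supported in `V * T`. Left uniform continuity comes from `φ`; right uniform
continuity needs `t v t⁻¹` small uniformly in `t`, which is the E-set condition.
Translation-compactness makes `F` weakly almost periodic (`mem_WAP_of_isTranslationCompact`): along
an ultrafilter leaving all compact sets, the translates `F_s` converge pointwise to some `g` of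
relatively compact support. If the convergence were not weak, the convex combinations of certain
`|F_s - g|` would have suprema bounded below. Hahn–Banach then yields a finitely additive
probability giving the sets `{|F_s - g| ≥ δ/2}` uniformly positive mass, so infinitely many of them
have the finite intersection property. For suitably chosen `s` this contradicts
translation-compactness.

Necessity. Weakly almost periodic functions are uniformly continuous under left translation
(separability and Baire) and satisfy Grothendieck's double limit property. If `T` were not uniformly
discrete, ever closer pairs in `T` interpolated by 1 and 0 would violate the former. If `V * T` were
not translation-compact, a recursion would give `T₁ ⊆ T` and sequences on which the function
attached to `T₁` has iterated limits 1 and 0, violating the latter. -/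

open Set Filter

/-! ### Recursive choice, finitely additive contents and Hahn–Banach -/

/-- Recursive construction of a sequence whose next term depends on the finite set of its
predecessors. -/
theorem exists_seq_finset_image {α : Type*} [DecidableEq α] (Q : Finset α → α → Prop)
    (h : ∀ S, ∃ y, Q S y) : ∃ f : ℕ → α, ∀ n, Q ((Finset.range n).image f) (f n) := by
  choose y hy using h
  let S : ℕ → Finset α := fun n => Nat.rec ∅ (fun _ s => insert (y s) s) n
  have hS : ∀ n, (Finset.range n).image (fun n => y (S n)) = S n := by
    intro n
    induction n with
    | zero => rfl
    | succ n ih => rw [Finset.range_add_one, Finset.image_insert, ih]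
  exact ⟨fun n => y (S n), fun n => by rw [hS]; exact hy _⟩

/-- A finitely additive probability content on all subsets of `X` (values at most one). -/
structure IsFinitelyAdditive {X : Type*} (m : Set X → ℝ) : Prop where
  nonneg : ∀ A, 0 ≤ m A
  le_one : ∀ A, m A ≤ 1
  empty : m ∅ = 0
  union_add_inter : ∀ A B, m (A ∪ B) + m (A ∩ B) = m A + m B

namespace IsFinitelyAdditive

variable {X : Type*} {m : Set X → ℝ}

theorem mono (hm : IsFinitelyAdditive m) {A B : Set X} (h : A ⊆ B) : m A ≤ m B := by
  have h1 := hm.union_add_inter A (B \ A)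
  rw [union_sdiff_cancel h, inter_sdiff_self, hm.empty] at h1
  linarith [hm.nonneg (B \ A)]

theorem union_le (hm : IsFinitelyAdditive m) (A B : Set X) : m (A ∪ B) ≤ m A + m B := by
  linarith [hm.union_add_inter A B, hm.nonneg (A ∩ B)]

/-- If `A` meets `B k` in uniformly positive mass for most `k`, then so does `A ∩ B k` for
most `k`. -/
theorem eventually_inter (hm : IsFinitelyAdditive m) (p : Ultrafilter ℕ) (B : ℕ → Set X)
    {A : Set X} (hA : ∃ a > 0, ∀ᶠ k in (p : Filter ℕ), a ≤ m (A ∩ B k)) :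
    ∀ᶠ k in (p : Filter ℕ), ∃ a > 0, ∀ᶠ j in (p : Filter ℕ), a ≤ m ((A ∩ B k) ∩ B j) := by
  obtain ⟨a, ha, hev⟩ := hA
  by_contra hcon
  rw [← Ultrafilter.eventually_not] at hcon
  have hnull : ∀ D : Set X, (¬ ∃ a > 0, ∀ᶠ j in (p : Filter ℕ), a ≤ m (D ∩ B j)) ↔
      ∀ a > 0, ∀ᶠ j in (p : Filter ℕ), m (D ∩ B j) < a := by
    intro D
    push Not
    refine forall₂_congr fun a _ => ?_
    rw [← Ultrafilter.frequently_iff_eventually]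
  -- Call `D` null if `m (D ∩ B j)` tends to 0 along `p`. By contradiction most `A ∩ B j` are null;
  -- adjoining one that overlaps `D` in mass below `a / 2` keeps `D` null and adds at least `a / 2`,
  -- so the mass eventually exceeds 1.
  have key : ∀ n : ℕ, ∃ D : Set X, (∀ a > 0, ∀ᶠ j in (p : Filter ℕ), m (D ∩ B j) < a) ∧
      n * (a / 2) ≤ m D := by
    intro n
    induction n with
    | zero =>
      refine ⟨∅, fun a ha => ?_, ?_⟩
      · simpa [hm.empty] using ha
      · simpa using hm.nonneg ∅
    | succ n ih =>
      obtain ⟨D, hD, hDm⟩ := ih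
      obtain ⟨j, ⟨hj1, hj2⟩, hj3⟩ := ((hev.and hcon).and (hD (a / 2) (by positivity))).exists
      rw [hnull] at hj2
      refine ⟨D ∪ (A ∩ B j), fun b hb => ?_, ?_⟩
      · filter_upwards [hD (b / 2) (by positivity), hj2 (b / 2) (by positivity)] with i h1 h2
        rw [union_inter_distrib_right]
        linarith [hm.union_le (D ∩ B i) ((A ∩ B j) ∩ B i)]
      · have h1 := hm.union_add_inter D (A ∩ B j)
        have h2 : m (D ∩ (A ∩ B j)) ≤ m (D ∩ B j) :=
          hm.mono fun x hx => ⟨hx.1, hx.2.2⟩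
        push_cast
        linarith
  obtain ⟨n, hn⟩ := exists_nat_gt (1 / (a / 2))
  obtain ⟨D, -, hD⟩ := key n
  rw [div_lt_iff₀ (by positivity)] at hn
  linarith [hm.le_one D]

/-- Among sets of uniformly positive mass there are infinitely many with the finite intersection
property. -/
theorem exists_infinite_inter_nonempty (hm : IsFinitelyAdditive m) (B : ℕ → Set X) {δ : ℝ}
    (hδ : 0 < δ) (hB : ∀ k, δ ≤ m (B k)) :
    ∃ J : Set ℕ, J.Infinite ∧ ∀ I : Finset ℕ, ↑I ⊆ J → (⋂ i ∈ I, B i).Nonempty := by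
  let p : Ultrafilter ℕ := hyperfilter ℕ
  let good : Set X → Prop := fun A => ∃ a > 0, ∀ᶠ k in (p : Filter ℕ), a ≤ m (A ∩ B k)
  have hgood : ∀ A, good A → A.Nonempty := by
    rintro A ⟨a, ha, hev⟩
    obtain ⟨k, hk⟩ := hev.exists
    by_contra hne
    rw [not_nonempty_iff_eq_empty.1 hne, empty_inter, hm.empty] at hk
    linarith
  obtain ⟨f, hf⟩ := exists_seq_finset_image
    (fun (S : Finset ℕ) k => good (⋂ i ∈ S, B i) →
      good ((⋂ i ∈ S, B i) ∩ B k) ∧ ∀ i ∈ S, i < k) (by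
    intro S
    by_cases hS : good (⋂ i ∈ S, B i)
    · have h1 : ∀ᶠ k in (p : Filter ℕ), ∀ i ∈ S, i < k := by
        have : ∀ᶠ k in atTop, ∀ i ∈ S, i < k :=
          (Finset.eventually_all S).2 fun i _ => eventually_gt_atTop i
        exact Nat.hyperfilter_le_atTop this
      obtain ⟨k, hk⟩ := ((hm.eventually_inter p B hS).and h1).exists
      exact ⟨k, fun _ => hk⟩
    · exact ⟨0, fun h => absurd h hS⟩)
  have hg : ∀ n, good (⋂ i ∈ (Finset.range n).image f, B i) := by
    intro n
    induction n with
    | zero => exact ⟨δ, hδ, by simpa using Eventually.of_forall hB⟩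
    | succ n ih =>
      rw [Finset.range_add_one, Finset.image_insert, Finset.set_biInter_insert, inter_comm]
      exact (hf n ih).1
  have hmono : StrictMono f := by
    refine strictMono_nat_of_lt_succ fun n => ?_
    refine (hf (n + 1) (hg _)).2 _ (Finset.mem_image_of_mem _ (by simp))
  refine ⟨range f, infinite_range_of_injective hmono.injective, fun I hI => ?_⟩
  -- As `n ≤ f n`, every `f n < N` is among the first `N` terms.
  obtain ⟨N, hN⟩ := I.exists_nat_subset_range
  refine (hgood _ (hg N)).mono (biInter_mono (fun i hi => ?_) fun _ _ => subset_rfl)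
  obtain ⟨n, rfl⟩ := hI hi
  exact Finset.mem_image_of_mem _
    (Finset.mem_range.2 ((hmono.le_apply).trans_lt (Finset.mem_range.1 (hN hi))))

end IsFinitelyAdditive

/-- A family of nonnegative uniformly bounded functions all of whose convex combinations have
supremum at least `δ` is uniformly non-small for some finitely additive probability. -/
theorem exists_isFinitelyAdditive_of_convexHull {X ι : Type*} [Nonempty ι] (u : ι → X → ℝ) {M δ : ℝ}
    (hδ : 0 < δ) (hu0 : ∀ i x, 0 ≤ u i x) (huM : ∀ i x, u i x ≤ M)
    (hconv : ∀ f ∈ convexHull ℝ (range u), ∃ x, δ ≤ f x) :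
    ∃ m : Set X → ℝ, IsFinitelyAdditive m ∧ ∃ η > 0, ∀ i, η ≤ m {x | δ / 2 ≤ u i x} := by
  let _ : TopologicalSpace X := ⊥
  have : DiscreteTopology X := ⟨rfl⟩
  let U : ι → X →ᵇ ℝ := fun i => BoundedContinuousFunction.ofNormedAddCommGroupDiscrete (u i) M
    fun x => by rw [Real.norm_eq_abs, abs_of_nonneg (hu0 i x)]; exact huM i x
  let ind : Set X → X →ᵇ ℝ := fun A =>
    BoundedContinuousFunction.ofNormedAddCommGroupDiscrete (A.indicator 1) 1 fun x => by
      by_cases hx : x ∈ A <;> simp [hx]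
  have hind : ∀ A x, ind A x = A.indicator 1 x := fun A x => rfl
  let c1 : X →ᵇ ℝ := BoundedContinuousFunction.const X 1
  -- `O` is bounded on one side only: it contains all `-n f` with `f ≥ 0`, which forces the
  -- separating functional to be positive.
  let O : Set (X →ᵇ ℝ) := {f | ∃ r < δ, ∀ x, f x ≤ r}
  let K : Set (X →ᵇ ℝ) := {f | ⇑f ∈ convexHull ℝ (range u)}
  have hOc : Convex ℝ O := by
    rintro f ⟨r, hr, hf⟩ g ⟨s, hs, hg⟩ a b ha hb hab
    refine ⟨max r s, max_lt hr hs, fun x => ?_⟩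
    have h1 := (hf x).trans (le_max_left r s)
    have h2 := (hg x).trans (le_max_right r s)
    calc a * f x + b * g x ≤ a * max r s + b * max r s := by gcongr
      _ = max r s := by rw [← add_mul, hab, one_mul]
  have hOo : IsOpen O := by
    rw [Metric.isOpen_iff]
    rintro f ⟨r, hr, hf⟩
    refine ⟨(δ - r) / 2, by linarith, fun g hg => ⟨(δ + r) / 2, by linarith, fun x => ?_⟩⟩
    have h1 := (BoundedContinuousFunction.dist_coe_le_dist (f := g) (g := f) x).trans hg.le
    rw [Real.dist_eq] at h1
    linarith [le_abs_self (g x - f x), hf x]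
  have hKc : Convex ℝ K := by
    intro f hf g hg a b ha hb hab
    exact convex_convexHull ℝ (range u) hf hg ha hb hab
  have hdisj : Disjoint O K := by
    rw [Set.disjoint_left]
    rintro f ⟨r, hr, hf⟩ hfK
    obtain ⟨x, hx⟩ := hconv f hfK
    linarith [hf x]
  obtain ⟨Λ, c, hΛO, hΛK⟩ := geometric_hahn_banach_open hOc hOo hKc hdisj
  have hpos : ∀ f : X →ᵇ ℝ, (∀ x, 0 ≤ f x) → 0 ≤ Λ f := by
    intro f hf
    by_contra! hneg
    obtain ⟨n, hn⟩ := exists_nat_gt (c / (-Λ f))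
    rw [div_lt_iff₀ (by linarith)] at hn
    have h1 : -((n : ℝ) • f) ∈ O := by
      refine ⟨0, hδ, fun x => ?_⟩
      have := mul_nonneg (Nat.cast_nonneg (α := ℝ) n) (hf x)
      simpa using this
    have h2 := hΛO _ h1
    rw [map_neg, map_smul, smul_eq_mul] at h2
    linarith
  have hΛmono : ∀ f g : X →ᵇ ℝ, (∀ x, f x ≤ g x) → Λ f ≤ Λ g := by
    intro f g hfg
    have := hpos (g - f) fun x => by simpa using hfg x
    rw [map_sub] at this
    linarith
  have hUK : ∀ i, c ≤ Λ (U i) := fun i => hΛK _ (subset_convexHull ℝ _ ⟨i, rfl⟩)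
  have hc0 : 0 < c := by
    have := hΛO 0 ⟨0, hδ, fun x => le_rfl⟩
    rwa [map_zero] at this
  obtain ⟨i₀⟩ := ‹Nonempty ι›
  obtain ⟨x₀, -⟩ := hconv _ (subset_convexHull ℝ _ ⟨i₀, rfl⟩)
  have hM : 0 ≤ M := (hu0 i₀ x₀).trans (huM i₀ x₀)
  have hc1 : 0 < Λ c1 := by
    by_contra! hle
    have h1 : Λ (U i₀) ≤ Λ (M • c1) := by
      refine hΛmono _ _ fun x => ?_
      change u i₀ x ≤ M * 1
      linarith [huM i₀ x]
    rw [map_smul, smul_eq_mul] at h1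
    linarith [hUK i₀, mul_nonneg hM (neg_nonneg.2 hle)]
  have hδc : δ * Λ c1 ≤ c := by
    by_contra! hlt
    have h1 : (c / Λ c1) • c1 ∈ O :=
      ⟨c / Λ c1, by rwa [div_lt_iff₀ hc1], fun x => by simp [c1]⟩
    have h2 := hΛO _ h1
    rw [map_smul, smul_eq_mul, div_mul_cancel₀ _ hc1.ne'] at h2
    exact lt_irrefl _ h2
  -- Splitting at `δ / 2`: as `δ Λ(1) ≤ c`, the set where `u i` is large must carry the remaining `δ
  -- Λ(1) / 2`. The final constant uses `M + 1` because `M` may be 0.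
  have hbound : ∀ i, c ≤ δ / 2 * Λ c1 + M * Λ (ind {x | δ / 2 ≤ u i x}) := by
    intro i
    refine (hUK i).trans ?_
    rw [← smul_eq_mul, ← smul_eq_mul, ← map_smul, ← map_smul, ← map_add]
    refine hΛmono _ _ fun x => ?_
    change u i x ≤ δ / 2 * 1 + M * indicator {x | δ / 2 ≤ u i x} 1 x
    by_cases hx : δ / 2 ≤ u i x
    · rw [indicator_of_mem (by exact hx)]
      simp only [Pi.one_apply, mul_one]
      linarith [huM i x]
    · rw [indicator_of_notMem (by exact hx)]
      linarith
  refine ⟨fun A => Λ (ind A) / Λ c1, ⟨fun A => ?_, fun A => ?_, ?_, fun A B => ?_⟩,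
    δ / (2 * (M + 1)), by positivity, fun i => ?_⟩
  · exact div_nonneg (hpos _ fun x => indicator_nonneg (fun _ _ => zero_le_one) x) hc1.le
  · rw [div_le_one hc1]
    refine hΛmono _ _ fun x => ?_
    exact indicator_le_self' (f := (1 : X → ℝ)) (fun _ _ => zero_le_one) x
  · have : ind ∅ = 0 := by ext x; simp [hind]
    rw [this, map_zero, zero_div]
  · rw [← add_div, ← add_div, ← map_add, ← map_add]
    congr 2
    ext x
    exact congrFun (indicator_union_add_inter (1 : X → ℝ) A B) x
  · have h1 := hbound i
    have h2 := hpos (ind {x | δ / 2 ≤ u i x}) fun x => indicator_nonneg (fun _ _ => zero_le_one) x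
    rw [le_div_iff₀ hc1, div_mul_eq_mul_div, div_le_iff₀ (by positivity)]
    nlinarith

/-! ### Compactness through ultrafilters, and weak convergence -/

/-- In a regular space, the closure of the range of a map along which every ultrafilter converges
is compact. -/
theorem isCompact_closure_range_of_ultrafilter {X Y : Type*} [TopologicalSpace X] [RegularSpace X]
    (φ : Y → X) (h : ∀ p : Ultrafilter Y, ∃ x, Tendsto φ p (𝓝 x)) :
    IsCompact (closure (range φ)) := by
  rw [isCompact_iff_ultrafilter_le_nhds]
  intro q hq
  rw [le_principal_iff] at hq
  -- `q` need not contain the range itself, only its closure. `Filter.bind q 𝓝` is generated by the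
  -- open members of `q`, and each of these meets the range.
  have hne : (comap φ (Filter.bind q 𝓝)).NeBot := by
    rw [comap_neBot_iff]
    intro W hW
    obtain ⟨y, hy, hyW⟩ := q.nonempty_of_mem (inter_mem hq (mem_bind'.1 hW))
    obtain ⟨_, hz, a, rfl⟩ := mem_closure_iff_nhds.1 hy W hyW
    exact ⟨a, hz⟩
  obtain ⟨x, hx⟩ := h (Ultrafilter.of (comap φ (Filter.bind q 𝓝)))
  refine ⟨x, mem_closure_of_tendsto hx (Eventually.of_forall mem_range_self), ?_⟩
  intro W hW
  obtain ⟨N, ⟨hN, hNc⟩, hNW⟩ := (closed_nhds_basis x).mem_iff.1 hW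
  refine mem_of_superset ?_ hNW
  by_contra hNq
  have h1 : Nᶜ ∈ Filter.bind (q : Filter X) 𝓝 := by
    have : Nᶜ ∈ q := Ultrafilter.compl_mem_iff_notMem.2 hNq
    exact mem_bind'.2 (mem_of_superset this fun y hy => hNc.isOpen_compl.mem_nhds hy)
  have h2 : φ ⁻¹' Nᶜ ∈ Ultrafilter.of (comap φ (Filter.bind (q : Filter X) 𝓝)) :=
    Ultrafilter.of_le _ (preimage_mem_comap h1)
  obtain ⟨a, ha1, ha2⟩ := Ultrafilter.nonempty_of_mem (inter_mem h2 (hx hN))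
  exact ha1 ha2

theorem tendsto_toWeakSpace_iff {E α : Type*} [NormedAddCommGroup E] [NormedSpace ℂ E]
    {l : Filter α} {f : α → E} {x : E} :
    Tendsto (fun a => toWeakSpace ℂ E (f a)) l (𝓝 (toWeakSpace ℂ E x)) ↔
      ∀ φ : StrongDual ℂ E, Tendsto (fun a => φ (f a)) l (𝓝 (φ x)) := by
  refine WeakBilin.tendsto_iff_forall_eval_tendsto (topDualPairing ℂ E).flip ?_
  intro a b hab
  rw [SeparatingDual.eq_iff_forall_dual_eq (R := ℂ)]
  exact fun g => DFunLike.congr_fun hab g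

/-! ### Functions supported in translation-compact sets are weakly almost periodic -/

section WeaklyAlmostPeriodic

variable {G : Type*} [Group G]

theorem mem_singleton_inv_mul_iff {b x : G} {S : Set G} : x ∈ {b⁻¹} * S ↔ b * x ∈ S := by
  simp [singleton_mul]

theorem mem_mul_singleton_inv_iff {b x : G} {S : Set G} : x ∈ S * {b⁻¹} ↔ x * b ∈ S := by
  simp [mul_singleton]

variable [TopologicalSpace G] [IsTopologicalGroup G]

/-- A sequence that is left uniformly discrete with respect to its order has no infinite
relatively compact subfamily. -/
theorem not_isRelativelyCompact_image {K : Set G} (hK : K ∈ 𝓝 (1 : G)) [T2Space G] {s : ℕ → G}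
    (hs : ∀ i j, i < j → s j * (s i)⁻¹ ∉ K) {J : Set ℕ} (hJ : J.Infinite) :
    ¬ IsRelativelyCompact (s '' J) := by
  intro hC
  have hinj : Function.Injective s := by
    have key : ∀ i j, i < j → s i ≠ s j := by
      intro i j hij h
      refine hs i j hij ?_
      rw [h, mul_inv_cancel]
      exact mem_of_mem_nhds hK
    intro i j hij
    rcases lt_trichotomy i j with h | h | h
    · exact absurd hij (key _ _ h)
    · exact h
    · exact absurd hij.symm (key _ _ h)
  obtain ⟨x, -, hx⟩ := (hJ.image hinj.injOn).exists_accPt_of_subset_isCompact hC subset_closure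
  have hcont : Tendsto (fun p : G × G => p.1 * p.2⁻¹) (𝓝 x ×ˢ 𝓝 x) (𝓝 1) := by
    have : Continuous fun p : G × G => p.1 * p.2⁻¹ := by fun_prop
    have h := this.tendsto (x, x)
    rwa [nhds_prod_eq, mul_inv_cancel] at h
  obtain ⟨W, hW, hWK⟩ := mem_prod_same_iff.1 (hcont hK)
  rw [accPt_iff_frequently] at hx
  obtain ⟨_, ⟨hax, i, -, rfl⟩, haW⟩ := (hx.and_eventually hW).exists
  obtain ⟨_, ⟨⟨hbx, j, -, rfl⟩, hbW⟩, hbi⟩ :=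
    ((hx.and_eventually hW).and_eventually (isOpen_ne.mem_nhds hax.symm)).exists
  rcases lt_trichotomy i j with h | h | h
  · exact hs i j h (hWK (mk_mem_prod hbW haW))
  · exact hbi (by rw [h])
  · exact hs j i h (hWK (mk_mem_prod haW hbW))

theorem exists_nhds_one_norm_mul_left_sub_le {φ : G → ℝ} (hφ : Continuous φ)
    (hc : HasCompactSupport φ) {ε : ℝ} (hε : 0 < ε) :
    ∃ N ∈ 𝓝 (1 : G), ∀ v ∈ N, ∀ x, |φ (v * x) - φ x| ≤ ε := by
  let _ : UniformSpace G := IsTopologicalGroup.rightUniformSpace G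
  have h := hc.uniformContinuous_of_continuous hφ
  have h2 := h (Metric.dist_mem_uniformity hε)
  rw [mem_map, uniformity_eq_comap_nhds_one', mem_comap] at h2
  obtain ⟨N, hN, h3⟩ := h2
  refine ⟨N, hN, fun v hv x => ?_⟩
  have h4 : (x, v * x) ∈ (fun p : G × G => p.2 * p.1⁻¹) ⁻¹' N := by simpa using hv
  have h5 : dist (φ x) (φ (v * x)) < ε := h3 h4
  rw [abs_sub_comm]
  exact h5.le

theorem exists_nhds_one_norm_mul_right_sub_le {φ : G → ℝ} (hφ : Continuous φ)
    (hc : HasCompactSupport φ) {ε : ℝ} (hε : 0 < ε) :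
    ∃ N ∈ 𝓝 (1 : G), ∀ v ∈ N, ∀ x, |φ (x * v) - φ x| ≤ ε := by
  obtain ⟨N, hN, h⟩ := exists_nhds_one_norm_mul_left_sub_le (φ := fun x => φ x⁻¹)
    (hφ.comp continuous_inv) (hc.comp_homeomorph (Homeomorph.inv G)) hε
  refine ⟨N⁻¹, inv_mem_nhds_one G hN, fun v hv x => ?_⟩
  simpa using h v⁻¹ hv x⁻¹

/-- Along an ultrafilter leaving all compact sets, the translates of a function supported in a
left translation-compact set converge pointwise to a continuous function of relatively compact
support. -/
theorem exists_tendsto_translate {F : G →ᵇ ℂ} {S : Set G} (hsupp : ∀ x, F x ≠ 0 → x ∈ S)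
    (hS : IsLeftTranslationCompact S)
    (hR : ∀ ε > 0, ∃ N ∈ 𝓝 (1 : G), ∀ v ∈ N, ∀ x, ‖F (x * v) - F x‖ ≤ ε)
    (p : Ultrafilter G) (hp : ∀ C : Set G, IsCompact C → C ∉ p) :
    ∃ g : G →ᵇ ℂ, (∀ x, Tendsto (fun s => F (s * x)) p (𝓝 (g x))) ∧
      IsRelativelyCompact {x | g x ≠ 0} := by
  have hlim : ∀ x, ∃ z ∈ Metric.closedBall (0 : ℂ) ‖F‖, Tendsto (fun s => F (s * x)) p (𝓝 z) := by
    intro x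
    obtain ⟨z, hz, hle⟩ := (isCompact_closedBall (0 : ℂ) ‖F‖).ultrafilter_le_nhds
      (p.map fun s => F (s * x)) (by
        rw [le_principal_iff]
        refine mem_map.2 (univ_mem' fun s => ?_)
        simpa using F.norm_coe_le_norm (s * x))
    exact ⟨z, hz, hle⟩
  choose g hgb hg using hlim
  have hgR : ∀ ε > 0, ∃ N ∈ 𝓝 (1 : G), ∀ v ∈ N, ∀ x, ‖g (x * v) - g x‖ ≤ ε := by
    intro ε hε
    obtain ⟨N, hN, h⟩ := hR ε hε
    refine ⟨N, hN, fun v hv x => ?_⟩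
    refine le_of_tendsto ((hg (x * v)).sub (hg x)).norm (Eventually.of_forall fun s => ?_)
    simpa [mul_assoc] using h v hv (s * x)
  have hgc : Continuous g := by
    rw [continuous_iff_continuousAt]
    intro x
    rw [ContinuousAt, Metric.tendsto_nhds]
    intro ε hε
    obtain ⟨N, hN, h⟩ := hgR (ε / 2) (by positivity)
    have h1 : Tendsto (fun y => x⁻¹ * y) (𝓝 x) (𝓝 1) := by
      have := (continuous_const_mul x⁻¹).tendsto x
      rwa [inv_mul_cancel] at this
    filter_upwards [h1 hN] with y hy
    have := h _ hy x
    rw [mul_inv_cancel_left] at this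
    rw [dist_eq_norm]
    linarith
  refine ⟨BoundedContinuousFunction.ofNormedAddCommGroup g hgc ‖F‖
    fun x => by simpa using hgb x, hg, ?_⟩
  change IsRelativelyCompact {x | g x ≠ 0}
  by_contra hL
  obtain ⟨I, hI, hfin, hc⟩ := hS _ hL
  -- If `g` is nonzero on the finite set `I`, then `s b ∈ S` for all `b ∈ I` and `p`-most `s`, so
  -- `p` would contain a relatively compact set.
  refine hp _ hc (mem_of_superset ?_ subset_closure)
  refine (biInter_mem hfin).2 fun b hb => ?_
  have h1 : ∀ᶠ s in (p : Filter G), F (s * b) ≠ 0 := (hg b).eventually_ne (hI hb)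
  filter_upwards [h1] with s hs
  exact mem_mul_singleton_inv_iff.2 (hsupp _ hs)

/-- Right uniform continuity makes the translates equicontinuous, which upgrades pointwise
convergence to uniform convergence on compact sets. -/
theorem eventually_norm_translate_sub_lt {F g : G →ᵇ ℂ} {p : Filter G}
    (hR : ∀ ε > 0, ∃ N ∈ 𝓝 (1 : G), ∀ v ∈ N, ∀ x, ‖F (x * v) - F x‖ ≤ ε)
    (hg : ∀ x, Tendsto (fun s => F (s * x)) p (𝓝 (g x)))
    {C : Set G} (hC : IsCompact C) {ε : ℝ} (hε : 0 < ε) :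
    ∀ᶠ s in p, ∀ x ∈ C, ‖F (s * x) - g x‖ < ε := by
  refine hC.induction_on (p := fun C => ∀ᶠ s in p, ∀ x ∈ C, ‖F (s * x) - g x‖ < ε) (by simp) ?_ ?_ ?_
  · intro s t hst ht
    filter_upwards [ht] with a ha x hx using ha x (hst hx)
  · intro s t hs ht
    filter_upwards [hs, ht] with a h1 h2 x hx
    exact hx.elim (h1 x) (h2 x)
  · intro x _
    obtain ⟨N, hN, h⟩ := hR (ε / 4) (by positivity)
    have h1 : Tendsto (fun y => x⁻¹ * y) (𝓝 x) (𝓝 1) := by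
      have := (continuous_const_mul x⁻¹).tendsto x
      rwa [inv_mul_cancel] at this
    have h2 : ∀ᶠ y in 𝓝 x, ‖g y - g x‖ < ε / 4 := by
      have := Metric.tendsto_nhds.1 (g.continuous.tendsto x) (ε / 4) (by positivity)
      simpa [dist_eq_norm] using this
    refine ⟨{y | x⁻¹ * y ∈ N ∧ ‖g y - g x‖ < ε / 4}, mem_nhdsWithin_of_mem_nhds
      (inter_mem (h1 hN) h2), ?_⟩
    have h3 := Metric.tendsto_nhds.1 (hg x) (ε / 4) (by positivity)
    filter_upwards [h3] with s hs y hy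
    have h4 := h _ hy.1 (s * x)
    rw [mul_assoc, mul_inv_cancel_left] at h4
    rw [dist_eq_norm] at hs
    calc ‖F (s * y) - g y‖
        = ‖(F (s * y) - F (s * x)) + (F (s * x) - g x) - (g y - g x)‖ := by ring_nf
      _ ≤ ‖F (s * y) - F (s * x)‖ + ‖F (s * x) - g x‖ + ‖g y - g x‖ :=
        (norm_sub_le _ _).trans (add_le_add_left (norm_add_le _ _) _)
      _ < ε := by linarith [hy.2]

/-- The real part of any functional tends to its value at the pointwise limit of the
translates. -/
theorem eventually_re_dual_translate_sub_lt [T2Space G] [LocallyCompactSpace G]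
    {F g : G →ᵇ ℂ} {S : Set G} (hsupp : ∀ x, F x ≠ 0 → x ∈ S)
    (hS : IsRightTranslationCompact S)
    (hR : ∀ ε > 0, ∃ N ∈ 𝓝 (1 : G), ∀ v ∈ N, ∀ x, ‖F (x * v) - F x‖ ≤ ε)
    (p : Ultrafilter G) (hp : ∀ C : Set G, IsCompact C → C ∉ p)
    (hg : ∀ x, Tendsto (fun s => F (s * x)) p (𝓝 (g x)))
    (hgc : IsRelativelyCompact {x | g x ≠ 0})
    (φ : StrongDual ℂ (G →ᵇ ℂ)) {ε : ℝ} (hε : 0 < ε) :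
    ∀ᶠ s in (p : Filter G), (φ (leftTranslate s F - g)).re < ε := by
  classical
  by_contra hcon
  rw [← Ultrafilter.eventually_not] at hcon
  simp only [not_lt] at hcon
  let A : Set G := {s | ε ≤ (φ (leftTranslate s F - g)).re}
  have hA : A ∈ p := hcon
  have hAne : Nonempty A := (p.nonempty_of_mem hA).to_subtype
  let δ : ℝ := ε / (‖φ‖ + 1)
  have hδ : 0 < δ := by positivity
  obtain ⟨m, hm, η, hη, hmη⟩ := exists_isFinitelyAdditive_of_convexHull
    (fun (s : A) x => ‖F (s * x) - g x‖) (M := ‖F‖ + ‖g‖) hδ (fun _ _ => norm_nonneg _)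
    (fun s x => (norm_sub_le _ _).trans (add_le_add (F.norm_coe_le_norm _) (g.norm_coe_le_norm _)))
    (by
      intro f hf
      -- A convex combination of the `|F_s - g|` dominates `|h|` for the same combination `h` of the
      -- `F_s - g`. Since `ε ≤ Re φ(h)`, the norm of `h` cannot be at most `δ`.
      have hsub : convexHull ℝ (range fun (s : A) x => ‖F (s * x) - g x‖) ⊆
          {f | ∃ h : G →ᵇ ℂ, ε ≤ (φ h).re ∧ ∀ x, ‖h x‖ ≤ f x} := by
        refine convexHull_min ?_ ?_
        · rintro _ ⟨s, rfl⟩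
          exact ⟨leftTranslate (s : G) F - g, s.2, fun x => le_rfl⟩
        · rintro f ⟨h, hh, hhf⟩ f' ⟨h', hh', hhf'⟩ a b ha hb hab
          refine ⟨(a : ℂ) • h + (b : ℂ) • h', ?_, fun x => ?_⟩
          · simp only [map_add, map_smul, smul_eq_mul, Complex.add_re, Complex.re_ofReal_mul]
            nlinarith
          · refine (norm_add_le _ _).trans ?_
            have h1 : ‖(a : ℂ) • h x‖ ≤ a * f x := by
              rw [norm_smul, Complex.norm_real, Real.norm_of_nonneg ha]
              exact mul_le_mul_of_nonneg_left (hhf x) ha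
            have h2 : ‖(b : ℂ) • h' x‖ ≤ b * f' x := by
              rw [norm_smul, Complex.norm_real, Real.norm_of_nonneg hb]
              exact mul_le_mul_of_nonneg_left (hhf' x) hb
            exact add_le_add h1 h2
      obtain ⟨h, hh, hhf⟩ := hsub hf
      by_contra! hlt
      have h1 : ‖h‖ ≤ δ := (BoundedContinuousFunction.norm_le hδ.le).2
        fun x => (hhf x).trans (hlt x).le
      have h2 : ‖φ h‖ ≤ ‖φ‖ * δ := (φ.le_opNorm h).trans (by gcongr)
      have h3 : (‖φ‖ + 1) * δ = ε := mul_div_cancel₀ _ (by positivity)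
      linarith [(Complex.re_le_norm (φ h))])
  obtain ⟨K, hK, hK1⟩ := exists_compact_mem_nhds (1 : G)
  -- Each new term stays discrete from its predecessors and is already close to `g` on the support
  -- of `g` and on every relatively compact intersection `⋂ b⁻¹ S` formed from predecessors.
  obtain ⟨s, hs⟩ := exists_seq_finset_image
    (fun (P : Finset G) y => y ∈ A ∧ (∀ a ∈ P, y * a⁻¹ ∉ K) ∧
      (∀ x ∈ closure {x | g x ≠ 0}, ‖F (y * x) - g x‖ < δ / 2) ∧
      ∀ I ∈ P.powerset, IsRelativelyCompact (⋂ b ∈ (I : Set G), {b⁻¹} * S) →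
        ∀ x ∈ ⋂ b ∈ (I : Set G), {b⁻¹} * S, ‖F (y * x) - g x‖ < δ / 2) (by
    intro P
    refine Eventually.exists (f := (p : Filter G)) ?_
    refine Eventually.and hA (Eventually.and ?_ (Eventually.and ?_ ?_))
    · refine (Finset.eventually_all P).2 fun a _ => ?_
      have h1 : K * {a} ∉ p := hp _ (hK.mul isCompact_singleton)
      filter_upwards [Ultrafilter.compl_mem_iff_notMem.2 h1] with y hy hya
      exact hy ⟨_, hya, a, rfl, by simp⟩
    · exact eventually_norm_translate_sub_lt hR hg hgc (by positivity)
    · refine (Finset.eventually_all _).2 fun I _ => ?_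
      by_cases hI : IsRelativelyCompact (⋂ b ∈ (I : Set G), {b⁻¹} * S)
      · filter_upwards [eventually_norm_translate_sub_lt hR hg hI (half_pos hδ)] with y hy _ x hx
        exact hy x (subset_closure hx)
      · exact Eventually.of_forall fun y h => absurd h hI)
  obtain ⟨J, hJ, hJI⟩ := hm.exists_infinite_inter_nonempty
    (fun k => {x | δ / 2 ≤ ‖F (s k * x) - g x‖}) hη (fun k => hmη ⟨s k, (hs k).1⟩)
  have hL : ¬ IsRelativelyCompact (s '' J) := by
    refine not_isRelativelyCompact_image hK1 (fun i j hij => ?_) hJ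
    exact (hs j).2.1 _ (Finset.mem_image_of_mem _ (Finset.mem_range.2 hij))
  obtain ⟨I, hIJ, hIfin, hIc⟩ := hS _ hL
  have hIJ' : ∀ b ∈ I, ∃ i ∈ J, s i = b := fun b hb => hIJ hb
  choose! j hjJ hj using hIJ'
  let I' : Finset ℕ := hIfin.toFinset.image j
  have hI'J : ∀ i ∈ I', i ∈ J := by
    intro i hi
    obtain ⟨b, hb, rfl⟩ := Finset.mem_image.1 hi
    exact hjJ _ (hIfin.mem_toFinset.1 hb)
  -- Take `k` beyond the indices of `I`, and `x` in the large sets of `k` and of all these indices.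
  -- Closeness on the support gives `g x = 0`, hence `b x ∈ S` for `b ∈ I`; closeness on `⋂ b⁻¹ S`
  -- then contradicts the largeness at `k`.
  obtain ⟨k, hkJ, hk⟩ := hJ.exists_gt (I'.sup id)
  have hik : ∀ i ∈ I', i < k := fun i hi => (Finset.le_sup (f := id) hi).trans_lt hk
  obtain ⟨x, hx⟩ := hJI (insert k I') (by
    intro i hi
    rcases Finset.mem_insert.1 hi with rfl | hi
    exacts [hkJ, hI'J i hi])
  simp only [mem_iInter, mem_ofPred_eq, Finset.mem_insert] at hx
  have hxk := hx k (Or.inl rfl)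
  have hgx : g x = 0 := by
    by_contra hne
    exact absurd ((hs k).2.2.1 x (subset_closure hne)) (not_lt.2 hxk)
  refine absurd ((hs k).2.2.2 hIfin.toFinset ?_ ?_ x ?_) (not_lt.2 hxk)
  · rw [Finset.mem_powerset]
    intro b hb
    have hbI := hIfin.mem_toFinset.1 hb
    exact Finset.mem_image.2 ⟨j b, Finset.mem_range.2 (hik _ (Finset.mem_image_of_mem _ hb)),
      hj _ hbI⟩
  · rwa [hIfin.coe_toFinset]
  · rw [hIfin.coe_toFinset, mem_iInter₂]
    intro b hb
    have h1 := hx (j b) (Or.inr (Finset.mem_image_of_mem _ (hIfin.mem_toFinset.2 hb)))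
    rw [hgx, sub_zero, hj _ hb] at h1
    exact mem_singleton_inv_mul_iff.2 (hsupp _ (norm_pos_iff.1 ((half_pos hδ).trans_le h1)))

/-- An ultrafilter containing a compact set converges in `G`, and left uniform continuity gives norm
convergence of the translates. Otherwise the pointwise limit is the weak limit, by the preceding
estimate applied to four rotations of each functional. -/
theorem mem_WAP_of_isTranslationCompact [T2Space G] [LocallyCompactSpace G]
    {F : G →ᵇ ℂ} {S : Set G} (hsupp : ∀ x, F x ≠ 0 → x ∈ S) (hS : IsTranslationCompact S)
    (hL : ∀ ε > 0, ∃ N ∈ 𝓝 (1 : G), ∀ v ∈ N, ∀ x, ‖F (v * x) - F x‖ ≤ ε)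
    (hR : ∀ ε > 0, ∃ N ∈ 𝓝 (1 : G), ∀ v ∈ N, ∀ x, ‖F (x * v) - F x‖ ≤ ε) :
    ⇑F ∈ WAP G := by
  refine ⟨F, rfl, isCompact_closure_range_of_ultrafilter _ fun p => ?_⟩
  by_cases hp : ∀ C : Set G, IsCompact C → C ∉ p
  · obtain ⟨g, hg, hgc⟩ := exists_tendsto_translate hsupp hS.2 hR p hp
    refine ⟨toWeakSpace ℂ _ g, tendsto_toWeakSpace_iff.2 fun φ => ?_⟩
    rw [Metric.tendsto_nhds]
    intro ε hε
    have key : ∀ c : ℂ, ∀ᶠ s in (p : Filter G), (c * φ (leftTranslate s F - g)).re < ε / 2 :=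
      fun c => eventually_re_dual_translate_sub_lt hsupp hS.1 hR p hp hg hgc (c • φ) (half_pos hε)
    filter_upwards [key 1, key (-1), key Complex.I, key (-Complex.I)] with s h1 h2 h3 h4
    rw [dist_eq_norm, ← map_sub]
    simp at h1 h2 h3 h4
    refine (Complex.norm_le_abs_re_add_abs_im _).trans_lt ?_
    have h5 : |(φ (leftTranslate s F - g)).re| < ε / 2 := abs_lt.2 ⟨by simp; linarith, by simp; linarith⟩
    have h6 : |(φ (leftTranslate s F - g)).im| < ε / 2 := abs_lt.2 ⟨by simp; linarith, by simp; linarith⟩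
    linarith
  · push Not at hp
    obtain ⟨C, hC, hCp⟩ := hp
    obtain ⟨s₀, -, hs₀⟩ := hC.ultrafilter_le_nhds p (le_principal_iff.2 hCp)
    refine ⟨toWeakSpace ℂ _ (leftTranslate s₀ F), tendsto_toWeakSpace_iff.2 fun φ => ?_⟩
    refine (φ.continuous.tendsto _).comp ?_
    rw [Metric.tendsto_nhds]
    intro ε hε
    obtain ⟨N, hN, h⟩ := hL (ε / 2) (by positivity)
    have h1 : Tendsto (fun y => y * s₀⁻¹) p (𝓝 1) := by
      have := (continuous_mul_const s₀⁻¹).tendsto s₀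
      rw [mul_inv_cancel] at this
      exact this.mono_left hs₀
    filter_upwards [h1 hN] with s hs
    refine lt_of_le_of_lt ?_ (half_lt_self hε)
    refine (BoundedContinuousFunction.dist_le (by positivity)).2 fun x => ?_
    have h2 := h _ hs (s₀ * x)
    rw [dist_eq_norm]
    simpa [leftTranslate, mul_assoc] using h2

end WeaklyAlmostPeriodic

/-! ### Gluing bumps along an E-set: sufficiency -/

section WeaklyAlmostPeriodic

variable {G : Type*} [Group G]

theorem mem_mul_singleton_iff {b x : G} {S : Set G} : x ∈ S * {b} ↔ x * b⁻¹ ∈ S := by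
  simp [mul_singleton]

theorem IsRightUniformlyDiscreteWrt.eq_of_mem {V T : Set G} [TopologicalSpace G]
    (h : IsRightUniformlyDiscreteWrt V T) {t t' x : G} (ht : t ∈ T) (ht' : t' ∈ T)
    (hx : x * t⁻¹ ∈ V) (hx' : x * t'⁻¹ ∈ V) : t = t' := by
  by_contra hne
  have h1 : x ∈ (V * {t}) ∩ (V * {t'}) :=
    ⟨mem_mul_singleton_iff.2 hx, mem_mul_singleton_iff.2 hx'⟩
  rw [h t ht t' ht' hne] at h1
  exact h1

variable [TopologicalSpace G] [IsTopologicalGroup G] [T2Space G] [LocallyCompactSpace G]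

/-- The function `∑ t ∈ T, φ (x t⁻¹) f t` is weakly almost periodic when `φ` is a bump function
supported in `V` and `V * T` is translation-compact. -/
theorem exists_mem_WAP_of_bump {V T : Set G} (hE : ∀ U ∈ 𝓝 (1 : G),
      (⋂ t ∈ T ∪ T⁻¹, {t⁻¹} * U * {t}) ∈ 𝓝 (1 : G))
    (hd : IsRightUniformlyDiscreteWrt V T) (hc : IsTranslationCompact (V * T))
    {φ : G → ℝ} (hφ : Continuous φ) (hφc : HasCompactSupport φ) (hφ1 : ∀ x, |φ x| ≤ 1)
    (hφV : ∀ x, φ x ≠ 0 → x ∈ V) {f : G → ℂ} {C : ℝ} (hC : 0 < C) (hf : ∀ t, ‖f t‖ ≤ C) :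
    ∃ F ∈ WAP G, (∀ t ∈ T, ∀ x, φ (x * t⁻¹) ≠ 0 → F x = φ (x * t⁻¹) * f t) ∧
      ∀ x, F x ≠ 0 → ∃ t ∈ T, φ (x * t⁻¹) ≠ 0 ∧ f t ≠ 0 := by
  classical
  let F : G → ℂ := fun x => if h : ∃ t ∈ T, φ (x * t⁻¹) ≠ 0 then
    φ (x * h.choose⁻¹) * f h.choose else 0
  have h1 : ∀ t ∈ T, ∀ x, φ (x * t⁻¹) ≠ 0 → F x = φ (x * t⁻¹) * f t := by
    intro t ht x hx
    have h : ∃ t ∈ T, φ (x * t⁻¹) ≠ 0 := ⟨t, ht, hx⟩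
    have heq : h.choose = t := hd.eq_of_mem h.choose_spec.1 ht (hφV _ h.choose_spec.2) (hφV _ hx)
    simp only [F, dif_pos h]
    rw [heq]
  have h2 : ∀ x, F x ≠ 0 → ∃ t ∈ T, φ (x * t⁻¹) ≠ 0 ∧ f t ≠ 0 := by
    intro x hx
    by_cases h : ∃ t ∈ T, φ (x * t⁻¹) ≠ 0
    · obtain ⟨t, ht, hxt⟩ := h
      rw [h1 t ht x hxt] at hx
      exact ⟨t, ht, hxt, right_ne_zero_of_mul hx⟩
    · simp [F, dif_neg h] at hx
  have hnorm : ∀ x δ, 0 ≤ δ → (∀ t ∈ T, |φ (x * t⁻¹)| ≤ δ) → ‖F x‖ ≤ δ * C := by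
    intro x δ hδ h
    by_cases hx : F x = 0
    · rw [hx, norm_zero]; positivity
    · obtain ⟨t, ht, hxt, -⟩ := h2 x hx
      rw [h1 t ht x hxt, norm_mul, Complex.norm_real]
      exact mul_le_mul (h t ht) (hf t) (norm_nonneg _) hδ
  have hnorm2 : ∀ x y δ, 0 ≤ δ → (∀ t ∈ T, |φ (x * t⁻¹) - φ (y * t⁻¹)| ≤ δ) →
      (∀ t ∈ T, φ (x * t⁻¹) = 0 ∨ φ (y * t⁻¹) = 0) → ‖F x‖ ≤ δ * C := by
    intro x y δ hδ h h0
    by_cases hx : F x = 0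
    · rw [hx, norm_zero]; positivity
    · obtain ⟨t, ht, hxt, -⟩ := h2 x hx
      rw [h1 t ht x hxt, norm_mul, Complex.norm_real]
      refine mul_le_mul ?_ (hf t) (norm_nonneg _) hδ
      have := h t ht
      rwa [(h0 t ht).resolve_left hxt, sub_zero] at this
  -- Either one `t` serves both `x` and `y`, or for each `t` one of the two bump values vanishes,
  -- and then each of `F x`, `F y` is separately at most `δ * C`; hence the factor 2.
  have hvar : ∀ x y δ, 0 ≤ δ → (∀ t ∈ T, |φ (x * t⁻¹) - φ (y * t⁻¹)| ≤ δ) →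
      ‖F x - F y‖ ≤ 2 * (δ * C) := by
    intro x y δ hδ h
    by_cases h0 : ∀ t ∈ T, φ (x * t⁻¹) = 0 ∨ φ (y * t⁻¹) = 0
    · have h3 := hnorm2 x y δ hδ h h0
      have h4 := hnorm2 y x δ hδ (fun t ht => by rw [abs_sub_comm]; exact h t ht)
        fun t ht => (h0 t ht).symm
      linarith [norm_sub_le (F x) (F y)]
    · push Not at h0
      obtain ⟨t, ht, hx, hy⟩ := h0
      rw [h1 t ht x hx, h1 t ht y hy, ← sub_mul, norm_mul, ← Complex.ofReal_sub,
        Complex.norm_real]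
      have := mul_le_mul (h t ht) (hf t) (norm_nonneg _) hδ
      rw [Real.norm_eq_abs]
      linarith [mul_nonneg hδ hC.le]
  have hL : ∀ ε > 0, ∃ N ∈ 𝓝 (1 : G), ∀ v ∈ N, ∀ x, ‖F (v * x) - F x‖ ≤ ε := by
    intro ε hε
    obtain ⟨N, hN, h⟩ := exists_nhds_one_norm_mul_left_sub_le hφ hφc
      (ε := ε / (2 * C)) (by positivity)
    refine ⟨N, hN, fun v hv x => (hvar _ _ (ε / (2 * C)) (by positivity) fun t _ => ?_).trans_eq
      (by field_simp)⟩
    simpa [mul_assoc] using h v hv (x * t⁻¹)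
  have hR : ∀ ε > 0, ∃ N ∈ 𝓝 (1 : G), ∀ v ∈ N, ∀ x, ‖F (x * v) - F x‖ ≤ ε := by
    intro ε hε
    obtain ⟨N, hN, h⟩ := exists_nhds_one_norm_mul_right_sub_le hφ hφc
      (ε := ε / (2 * C)) (by positivity)
    refine ⟨_, hE N hN, fun v hv x => (hvar _ _ (ε / (2 * C)) (by positivity) fun t ht => ?_).trans_eq
      (by field_simp)⟩
    -- The E-set condition enters here: moving `v` across `t⁻¹` conjugates it, and one neighbourhood
    -- of `v` works for all `t`.
    have hvt : t * v * t⁻¹ ∈ N := by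
      have := mem_iInter₂.1 hv t (Or.inl ht)
      rw [mem_mul_singleton_iff, mem_singleton_inv_mul_iff] at this
      rwa [mul_assoc]
    have := h _ hvt (x * t⁻¹)
    rwa [show x * t⁻¹ * (t * v * t⁻¹) = x * v * t⁻¹ by group] at this
  have hcont : Continuous F := by
    rw [continuous_iff_continuousAt]
    intro x
    rw [ContinuousAt, Metric.tendsto_nhds]
    intro ε hε
    obtain ⟨N, hN, h⟩ := hL (ε / 2) (by positivity)
    have h1 : Tendsto (fun y => y * x⁻¹) (𝓝 x) (𝓝 1) := by
      have := (continuous_mul_const x⁻¹).tendsto x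
      rwa [mul_inv_cancel] at this
    filter_upwards [h1 hN] with y hy
    have := h _ hy x
    rw [inv_mul_cancel_right] at this
    rw [dist_eq_norm]
    linarith
  refine ⟨F, ?_, h1, h2⟩
  refine mem_WAP_of_isTranslationCompact (F := BoundedContinuousFunction.ofNormedAddCommGroup F
    hcont (1 * C) fun x => hnorm x 1 zero_le_one fun t _ => hφ1 _) (S := V * T) ?_ hc hL hR
  intro x hx
  obtain ⟨t, ht, hxt, -⟩ := h2 x hx
  exact ⟨x * t⁻¹, hφV _ hxt, t, ht, by simp⟩

/-- A single bump, equal to 1 near the identity, serves both conditions: interpolation takes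
arbitrary coefficients, approximation takes the indicator of `T₁`. -/
theorem isApproximableInterpolationSet_WAP {V T : Set G} (hE : ∀ U ∈ 𝓝 (1 : G),
      (⋂ t ∈ T ∪ T⁻¹, {t⁻¹} * U * {t}) ∈ 𝓝 (1 : G)) (hV : V ∈ 𝓝 (1 : G))
    (hd : IsRightUniformlyDiscreteWrt V T) (hc : IsTranslationCompact (V * T)) :
    IsApproximableInterpolationSet (WAP G) T := by
  classical
  have main : ∀ U ∈ 𝓝 (1 : G), ∃ V₁ V₂ : Set G,
      IsOpen V₁ ∧ (1 : G) ∈ V₁ ∧ IsOpen V₂ ∧ (1 : G) ∈ V₂ ∧ closure V₁ ⊆ V₂ ∧ V₂ ⊆ U ∧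
      ∀ (f : G → ℂ) (C : ℝ), (∀ t, ‖f t‖ ≤ C) → ∃ F ∈ WAP G,
        (∀ t ∈ T, ∀ x, x * t⁻¹ ∈ V₁ → F x = f t) ∧
        ∀ x, F x ≠ 0 → ∃ t ∈ T, x * t⁻¹ ∈ V₂ ∧ f t ≠ 0 := by
    intro U hU
    obtain ⟨K₂, hK₂, hK₂U, hK₂c⟩ := local_compact_nhds (inter_mem hU hV)
    obtain ⟨K₁, hK₁, hK₁U, hK₁c⟩ := local_compact_nhds (interior_mem_nhds.2 hK₂)
    obtain ⟨φ, hφ1, hφ0, hφc, hφb⟩ := exists_continuous_one_zero_of_isCompact hK₁c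
      isOpen_interior.isClosed_compl (disjoint_compl_right_iff_subset.2 hK₁U)
    have hφ2 : ∀ x, φ x ≠ 0 → x ∈ interior K₂ := by
      intro x hx
      by_contra hn
      exact hx (hφ0 hn)
    refine ⟨interior K₁, interior K₂, isOpen_interior, mem_interior_iff_mem_nhds.2 hK₁,
      isOpen_interior, mem_interior_iff_mem_nhds.2 hK₂,
      (closure_minimal interior_subset hK₁c.isClosed).trans hK₁U,
      interior_subset.trans (hK₂U.trans inter_subset_left), fun f C hf => ?_⟩
    obtain ⟨F, hF, h1, h2⟩ := exists_mem_WAP_of_bump hE hd hc φ.continuous hφc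
      (fun x => by rw [abs_of_nonneg (hφb x).1]; exact (hφb x).2)
      (fun x hx => (hK₂U (interior_subset (hφ2 x hx))).2)
      (C := max C 1) (by positivity) (fun t => (hf t).trans (le_max_left _ _))
    refine ⟨F, hF, fun t ht x hx => ?_, fun x hx => ?_⟩
    · have h3 : φ (x * t⁻¹) = 1 := hφ1 (interior_subset hx)
      rw [h1 t ht x (by rw [h3]; exact one_ne_zero), h3]
      simp
    · obtain ⟨t, ht, h3, h4⟩ := h2 x hx
      exact ⟨t, ht, hφ2 _ h3, h4⟩
  refine ⟨fun f ⟨C, hf⟩ => ?_, fun U hU => ?_⟩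
  · obtain ⟨V₁, V₂, -, h1, -, -, -, -, H⟩ := main univ univ_mem
    obtain ⟨F, hF, hFf, -⟩ := H (fun x => if h : x ∈ T then f ⟨x, h⟩ else 0) (max C 0) (by
      intro t
      by_cases ht : t ∈ T
      · simp only [dif_pos ht]
        exact (hf _).trans (le_max_left _ _)
      · simp [dif_neg ht])
    refine ⟨F, hF, fun t => ?_⟩
    rw [hFf t t.2 t (by rwa [mul_inv_cancel]), dif_pos t.2]
  · obtain ⟨V₁, V₂, ho1, h1, ho2, h2, hcl, hsub, H⟩ := main U hU
    refine ⟨V₁, V₂, ho1, h1, ho2, h2, hcl, hsub, fun T₁ hT₁ => ?_⟩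
    obtain ⟨F, hF, hF1, hF2⟩ := H (T₁.indicator 1) 1 (by
      intro t
      by_cases ht : t ∈ T₁ <;> simp [ht])
    refine ⟨F, hF, ?_, fun x hx => ?_⟩
    · rintro _ ⟨v, hv, t, ht, rfl⟩
      change F (v * t) = 1
      rw [hF1 t (hT₁ ht) _ (by simpa using hv), indicator_of_mem ht, Pi.one_apply]
    · by_contra hne
      obtain ⟨t, -, htV, ht⟩ := hF2 x hne
      exact hx ⟨_, htV, t, mem_of_indicator_ne_zero ht, by simp⟩

end WeaklyAlmostPeriodic

/-! ### Double limits and uniform continuity of weakly almost periodic functions -/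

section WeaklyAlmostPeriodic

theorem exists_mem_notMem_of_not_isRelativelyCompact {X : Type*} [TopologicalSpace X] [T2Space X]
    {L C : Set X}
    (hL : ¬ IsRelativelyCompact L) (hC : IsCompact C) : ∃ l ∈ L, l ∉ C := by
  by_contra! h
  exact hL (hC.of_isClosed_subset isClosed_closure (closure_minimal h hC.isClosed))

/-- Mazur's theorem: convex sets have the same norm and weak closure. -/
theorem Convex.isClosed_image_toWeakSpace {E : Type*} [NormedAddCommGroup E] [NormedSpace ℂ E]
    {s : Set E} (hs : Convex ℝ s) (hc : IsClosed s) : IsClosed (toWeakSpace ℂ E '' s) := by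
  rw [← closure_eq_iff_isClosed, ← hs.toWeakSpace_closure ℂ, hc.closure_eq]

theorem isClosed_setOf_tendsto_comp {X : Type*} [TopologicalSpace X] (x : ℕ → X) (a : ℂ) :
    IsClosed {f : X →ᵇ ℂ | Tendsto (fun n => f (x n)) atTop (𝓝 a)} := by
  refine isClosed_of_closure_subset fun f hf => ?_
  rw [mem_ofPred_eq, Metric.tendsto_nhds]
  intro ε hε
  obtain ⟨g, hg, hfg⟩ := Metric.mem_closure_iff.1 hf (ε / 2) (by positivity)
  filter_upwards [Metric.tendsto_nhds.1 hg (ε / 2) (by positivity)] with n hn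
  calc dist (f (x n)) a ≤ dist (f (x n)) (g (x n)) + dist (g (x n)) a := dist_triangle _ _ _
    _ < ε := by linarith [BoundedContinuousFunction.dist_coe_le_dist (f := f) (g := g) (x n)]

theorem convex_setOf_tendsto_comp {X : Type*} [TopologicalSpace X] (x : ℕ → X) (a : ℂ) :
    Convex ℝ {f : X →ᵇ ℂ | Tendsto (fun n => f (x n)) atTop (𝓝 a)} := by
  intro f hf g hg r s _ _ hrs
  have h := (Tendsto.const_smul hf r).add (Tendsto.const_smul hg s)
  rwa [← add_smul, hrs, one_smul] at h

variable {G : Type*} [Group G] [TopologicalSpace G] [IsTopologicalGroup G]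

theorem exists_tendsto_leftTranslate {F : G →ᵇ ℂ}
    (hF : IsCompact (closure (range fun s : G => toWeakSpace ℂ (G →ᵇ ℂ) (leftTranslate s F))))
    {α : Type*} (p : Ultrafilter α) (s : α → G) :
    ∃ g : G →ᵇ ℂ, Tendsto (fun a => toWeakSpace ℂ (G →ᵇ ℂ) (leftTranslate (s a) F)) p
      (𝓝 (toWeakSpace ℂ (G →ᵇ ℂ) g)) ∧ ∀ x, Tendsto (fun a => F (s a * x)) p (𝓝 (g x)) := by
  obtain ⟨y, -, hy⟩ := hF.ultrafilter_le_nhds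
    (p.map fun a => toWeakSpace ℂ (G →ᵇ ℂ) (leftTranslate (s a) F)) (by
      rw [le_principal_iff]
      exact mem_map.2 (univ_mem' fun a => subset_closure ⟨s a, rfl⟩))
  obtain ⟨g, rfl⟩ := (toWeakSpace ℂ (G →ᵇ ℂ)).surjective y
  have hy' : Tendsto (fun a => toWeakSpace ℂ (G →ᵇ ℂ) (leftTranslate (s a) F)) p
      (𝓝 (toWeakSpace ℂ (G →ᵇ ℂ) g)) := hy
  exact ⟨g, hy', fun x => tendsto_toWeakSpace_iff.1 hy' (BoundedContinuousFunction.evalCLM ℂ x)⟩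

/-- Grothendieck's double limit property of weakly almost periodic functions. -/
theorem eq_of_mem_WAP_of_tendsto {h : G → ℂ} (hh : h ∈ WAP G) {s x : ℕ → G} {a b : ℂ}
    (ha : ∀ n, Tendsto (fun m => h (s n * x m)) atTop (𝓝 a))
    (hb : ∀ m, Tendsto (fun n => h (s n * x m)) atTop (𝓝 b)) : a = b := by
  obtain ⟨F, rfl, hF⟩ := hh
  obtain ⟨g, hg, hgx⟩ := exists_tendsto_leftTranslate hF (hyperfilter ℕ) s
  have hgb : ∀ m, g (x m) = b := fun m =>
    tendsto_nhds_unique (hgx (x m)) ((hb m).mono_left Nat.hyperfilter_le_atTop)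
  -- The functions tending to `a` along `x` form a weakly closed set containing all `F_{s n}`, hence
  -- also their weak limit `g`, which is constantly `b` along `x`.
  have hcl := (convex_setOf_tendsto_comp x a).isClosed_image_toWeakSpace
    (isClosed_setOf_tendsto_comp x a)
  obtain ⟨g', hg', hgg'⟩ := hcl.mem_of_tendsto hg
    (Eventually.of_forall fun n => mem_image_of_mem _ (ha n))
  rw [(toWeakSpace ℂ (G →ᵇ ℂ)).injective hgg'] at hg'
  simp only [mem_ofPred_eq, hgb] at hg'
  exact tendsto_nhds_unique hg' tendsto_const_nhds |>.symm ▸ rfl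

/-- Compactness supplies a weak limit along every ultrafilter converging to `s`, and continuity of
`F` identifies it pointwise. -/
theorem continuous_toWeakSpace_leftTranslate {F : G →ᵇ ℂ}
    (hF : IsCompact (closure (range fun s : G => toWeakSpace ℂ (G →ᵇ ℂ) (leftTranslate s F)))) :
    Continuous fun s : G => toWeakSpace ℂ (G →ᵇ ℂ) (leftTranslate s F) := by
  rw [continuous_iff_continuousAt]
  intro s
  rw [ContinuousAt, tendsto_iff_ultrafilter]
  intro p hp
  obtain ⟨g, hg, hgx⟩ := exists_tendsto_leftTranslate hF p id
  have : g = leftTranslate s F := by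
    ext x
    have h1 : Continuous fun y => F (y * x) := by fun_prop
    exact tendsto_nhds_unique (hgx x) ((h1.tendsto s).mono_left hp)
  rwa [← this]

/-- Weakly almost periodic functions are uniformly continuous under small left translations. -/
theorem exists_nhds_one_norm_sub_le_of_mem_WAP [LocallyCompactSpace G]
    [TopologicalSpace.MetrizableSpace G] {h : G → ℂ} (hh : h ∈ WAP G) {ε : ℝ} (hε : 0 < ε) :
    ∃ N ∈ 𝓝 (1 : G), ∀ v ∈ N, ∀ x, ‖h (v * x) - h x‖ ≤ ε := by
  obtain ⟨F, rfl, hF⟩ := hh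
  obtain ⟨K, hK, hK1⟩ := exists_compact_mem_nhds (1 : G)
  obtain ⟨D, hD, hKD⟩ := hK.isSeparable
  -- The closed span of countably many translates is weakly closed, so it contains all translates by
  -- `K`; hence these are norm separable.
  let Y : Submodule ℂ (G →ᵇ ℂ) := Submodule.span ℂ ((fun s => leftTranslate s F) '' D)
  have hY : TopologicalSpace.IsSeparable (closure (Y : Set (G →ᵇ ℂ))) :=
    ((hD.image _).isSeparable.span).closure
  have hKY : ∀ s ∈ K, leftTranslate s F ∈ closure (Y : Set (G →ᵇ ℂ)) := by
    intro s hs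
    have h1 : toWeakSpace ℂ (G →ᵇ ℂ) (leftTranslate s F) ∈
        closure (toWeakSpace ℂ (G →ᵇ ℂ) '' (Y : Set (G →ᵇ ℂ))) := by
      refine closure_mono ?_ (image_closure_subset_closure_image
        (continuous_toWeakSpace_leftTranslate hF) (mem_image_of_mem _ (hKD hs)))
      rintro _ ⟨d, hd, rfl⟩
      exact mem_image_of_mem _ (Submodule.subset_span (mem_image_of_mem _ hd))
    have hYc : Convex ℝ (Y : Set (G →ᵇ ℂ)) := (Y.restrictScalars ℝ).convex
    rw [← hYc.toWeakSpace_closure ℂ] at h1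
    obtain ⟨f, hf, hfs⟩ := h1
    rwa [← (toWeakSpace ℂ (G →ᵇ ℂ)).injective hfs]
  obtain ⟨E, hE, hYE⟩ := hY
  have := hE.to_subtype
  -- Countably many closed sets cover `G`, with `none` absorbing the complement of `interior K`. By
  -- Baire, some `ε / 2`-ball of functions contains the translates by a whole neighbourhood of some
  -- `s₀`.
  let A : Option E → Set G := fun o => o.elim (interior K)ᶜ
    fun e => {s | ∀ x, ‖F (s * x) - (e : G →ᵇ ℂ) x‖ ≤ ε / 2}
  have hAc : ∀ o, IsClosed (A o) := by
    rintro (_ | e)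
    · exact isOpen_interior.isClosed_compl
    · have : A (some e) = ⋂ x, {s | ‖F (s * x) - (e : G →ᵇ ℂ) x‖ ≤ ε / 2} := by
        ext s; simp [A]
      rw [this]
      refine isClosed_iInter fun x => isClosed_le ?_ continuous_const
      fun_prop
  have hAU : ⋃ o, A o = univ := by
    rw [eq_univ_iff_forall]
    intro s
    by_cases hs : s ∈ interior K
    · obtain ⟨e, he, hse⟩ := Metric.mem_closure_iff.1 (hYE (hKY s (interior_subset hs)))
        (ε / 2) (by positivity)
      refine mem_iUnion.2 ⟨some ⟨e, he⟩, fun x => ?_⟩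
      have := (BoundedContinuousFunction.dist_coe_le_dist x).trans hse.le
      rwa [dist_eq_norm] at this
    · exact mem_iUnion.2 ⟨none, hs⟩
  obtain ⟨s₀, hs₀K, hs₀⟩ := (dense_iUnion_interior_of_closed hAc hAU).inter_open_nonempty
    (interior K) isOpen_interior ⟨1, mem_interior_iff_mem_nhds.2 hK1⟩
  obtain ⟨o, ho⟩ := mem_iUnion.1 hs₀
  rcases o with _ | e
  · exact absurd hs₀K (interior_subset ho)
  · have h1 : Tendsto (fun v => v * s₀) (𝓝 1) (𝓝 s₀) := by
      have := (continuous_mul_const s₀).tendsto 1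
      rwa [one_mul] at this
    refine ⟨_, h1 (mem_interior_iff_mem_nhds.1 ho), fun v hv x => ?_⟩
    have h2 : ‖F (v * s₀ * (s₀⁻¹ * x)) - (e : G →ᵇ ℂ) (s₀⁻¹ * x)‖ ≤ ε / 2 := hv _
    have h3 : ‖F (s₀ * (s₀⁻¹ * x)) - (e : G →ᵇ ℂ) (s₀⁻¹ * x)‖ ≤ ε / 2 := interior_subset ho _
    rw [mul_inv_cancel_left] at h3
    rw [mul_assoc, mul_inv_cancel_left] at h2
    calc ‖F (v * x) - F x‖ = ‖(F (v * x) - (e : G →ᵇ ℂ) (s₀⁻¹ * x)) -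
          (F x - (e : G →ᵇ ℂ) (s₀⁻¹ * x))‖ := by ring_nf
      _ ≤ ε := (norm_sub_le _ _).trans (by linarith)

/-! ### Necessity of uniform discreteness -/

/-- Otherwise an injective sequence of `T` converges, and interpolating 1 on its even and 0 on its
odd terms contradicts continuity at the limit. -/
theorem IsInterpolationSet.finite_inter_isCompact [TopologicalSpace.MetrizableSpace G] {T : Set G}
    (hT : IsInterpolationSet (WAP G) T) {C : Set G} (hC : IsCompact C) : (T ∩ C).Finite := by
  classical
  by_contra hinf
  have : Infinite ↥(T ∩ C) := Set.infinite_coe_iff.2 hinf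
  let u : ℕ ↪ ↥(T ∩ C) := Infinite.natEmbedding _
  obtain ⟨a, -, ψ, hψ, hlim⟩ := hC.tendsto_subseq (x := fun n => (u n : G)) fun n => (u n).2.2
  obtain ⟨h, ⟨F, rfl, -⟩, hF⟩ := hT (fun t => if ∃ n, (t : G) = u (ψ (2 * n)) then 1 else 0)
    ⟨1, fun t => by split_ifs <;> simp⟩
  have hF' : ∀ n, F (u n) = if ∃ k, (u n : G) = u (ψ (2 * k)) then 1 else 0 :=
    fun n => hF ⟨u n, (u n).2.1⟩
  have h2 : Tendsto (fun n => 2 * n) atTop atTop :=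
    tendsto_atTop_mono (fun n => by change n ≤ _; lia) tendsto_id
  have h3 : Tendsto (fun n => 2 * n + 1) atTop atTop :=
    tendsto_atTop_mono (fun n => by change n ≤ _; lia) tendsto_id
  have hlim1 := (F.continuous.tendsto a).comp (hlim.comp h2)
  have hlim0 := (F.continuous.tendsto a).comp (hlim.comp h3)
  have e1 : (F ∘ ((fun n => (u n : G)) ∘ ψ) ∘ fun n => 2 * n) = fun _ => 1 := by
    funext n
    simp only [Function.comp_apply, hF']
    exact if_pos ⟨n, rfl⟩
  have e0 : (F ∘ ((fun n => (u n : G)) ∘ ψ) ∘ fun n => 2 * n + 1) = fun _ => 0 := by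
    funext n
    simp only [Function.comp_apply, hF']
    refine if_neg ?_
    rintro ⟨k, hk⟩
    have := hψ.injective (u.injective (Subtype.ext hk))
    lia
  rw [e1] at hlim1
  rw [e0] at hlim0
  exact one_ne_zero ((tendsto_nhds_unique tendsto_const_nhds hlim1).trans
    (tendsto_nhds_unique hlim0 tendsto_const_nhds))

theorem IsInterpolationSet.exists_isRightUniformlyDiscreteWrt [LocallyCompactSpace G]
    [TopologicalSpace.MetrizableSpace G] {T : Set G} (hT : IsInterpolationSet (WAP G) T) :
    ∃ V ∈ 𝓝 (1 : G), IsRightUniformlyDiscreteWrt V T := by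
  classical
  by_contra! hcon
  have hpair : ∀ N ∈ 𝓝 (1 : G), ∃ t ∈ T, ∃ t' ∈ T, t ≠ t' ∧ t * t'⁻¹ ∈ N := by
    intro N hN
    have hcont : Tendsto (fun q : G × G => q.1⁻¹ * q.2) (𝓝 1 ×ˢ 𝓝 1) (𝓝 1) := by
      have : Continuous fun q : G × G => q.1⁻¹ * q.2 := by fun_prop
      have h := this.tendsto (1, 1)
      rwa [nhds_prod_eq, inv_one, one_mul] at h
    obtain ⟨W, hW, hWN⟩ := mem_prod_same_iff.1 (hcont hN)
    have := hcon W hW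
    simp only [IsRightUniformlyDiscreteWrt] at this
    push Not at this
    obtain ⟨t, ht, t', ht', hne, x, hx, hx'⟩ := this
    refine ⟨t, ht, t', ht', hne, ?_⟩
    have h1 := hWN (mk_mem_prod (mem_mul_singleton_iff.1 hx) (mem_mul_singleton_iff.1 hx'))
    simpa using h1
  have hisol : ∀ a : G, ∃ N ∈ 𝓝 (1 : G), ∀ v ∈ N, v * a ∈ T → v = 1 := by
    intro a
    obtain ⟨K, hK, hKa⟩ := exists_compact_mem_nhds a
    have hfin : ((T ∩ K) \ {a}).Finite := (hT.finite_inter_isCompact hK).sdiff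
    have h1 : Tendsto (fun v => v * a) (𝓝 1) (𝓝 a) := by
      have := (continuous_mul_const a).tendsto 1
      rwa [one_mul] at this
    refine ⟨_, h1 (inter_mem hKa (hfin.isClosed.isOpen_compl.mem_nhds (x := a) (by simp))), ?_⟩
    rintro v ⟨hv, hv'⟩ hvT
    by_contra hne
    exact hv' ⟨⟨hvT, hv⟩, by simpa using hne⟩
  choose N hN hNT using hisol
  obtain ⟨B, hB⟩ := (𝓝 (1 : G)).exists_antitone_basis
  -- Each term holds an index and a pair in `T` whose quotient lies in that basic neighbourhood. By
  -- isolation, a pair with small enough quotient cannot contain an earlier point, so first and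
  -- second members never coincide.
  obtain ⟨f, hf⟩ := exists_seq_finset_image (fun (S : Finset (ℕ × G × G)) y =>
    (∀ a ∈ S, a.1 < y.1) ∧ y.2.1 ∈ T ∧ y.2.2 ∈ T ∧ y.2.1 ≠ y.2.2 ∧
      y.2.1 * y.2.2⁻¹ ∈ B y.1 ∧ ∀ a ∈ S, y.2.2 ≠ a.2.1 ∧ y.2.1 ≠ a.2.2) (by
    intro S
    have h1 : (⋂ a ∈ S, N a.2.1 ∩ (N a.2.2)⁻¹) ∩ B (S.sup Prod.fst + 1) ∈ 𝓝 (1 : G) :=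
      inter_mem ((biInter_finset_mem S).2 fun a _ =>
        inter_mem (hN _) (inv_mem_nhds_one G (hN _))) (hB.1.mem_of_mem trivial)
    obtain ⟨t, ht, t', ht', hne, hmem, hBm⟩ := hpair _ h1
    refine ⟨(S.sup Prod.fst + 1, t, t'), fun a ha => Nat.lt_succ_of_le (Finset.le_sup ha),
      ht, ht', hne, hBm, fun a ha => ⟨?_, ?_⟩⟩
    · rintro rfl
      have := hNT _ _ (mem_iInter₂.1 hmem a ha).1 (by simpa using ht)
      exact hne (mul_inv_eq_one.1 this)
    · rintro rfl
      have := hNT _ _ (mem_iInter₂.1 hmem a ha).2 (by simpa using ht')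
      exact hne (mul_inv_eq_one.1 (inv_eq_one.1 this)))
  have hlt : ∀ i j, i < j → f i ∈ (Finset.range j).image f := fun i j hij =>
    Finset.mem_image_of_mem _ (Finset.mem_range.2 hij)
  have hmono : StrictMono fun n => (f n).1 := fun i j hij => (hf j).1 _ (hlt i j hij)
  have hsep : ∀ j k, (f k).2.2 ≠ (f j).2.1 := by
    intro j k
    rcases lt_trichotomy j k with h | h | h
    · exact ((hf k).2.2.2.2.2 _ (hlt j k h)).1
    · rw [h]; exact (hf k).2.2.2.1.symm
    · exact ((hf j).2.2.2.2.2 _ (hlt k j h)).2.symm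
  obtain ⟨h, hh, hhf⟩ := hT (fun t => if ∃ n, (t : G) = (f n).2.1 then 1 else 0)
    ⟨1, fun t => by split_ifs <;> simp⟩
  obtain ⟨W, hW, hWh⟩ := exists_nhds_one_norm_sub_le_of_mem_WAP hh one_half_pos
  obtain ⟨n, -, hn⟩ := hB.1.mem_iff.1 hW
  have h1 := hWh _ (hn (hB.2 (hmono.le_apply (x := n)) (hf n).2.2.2.2.1)) (f n).2.2
  rw [inv_mul_cancel_right, hhf ⟨_, (hf n).2.1⟩, hhf ⟨_, (hf n).2.2.1⟩, if_pos ⟨n, rfl⟩,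
    if_neg (by rintro ⟨j, hj⟩; exact hsep j n hj)] at h1
  norm_num at h1

/-! ### Necessity of translation-compactness -/

/-- If finite intersections of the sets `{x | c b x ∈ V * T}`, `b ∈ L`, are never relatively
compact, there are a part `T₁` of `T` and sequences for which `c (l i) (x n)` lies in `V * T₁` for
`i ≤ n` and outside `W * T₁` for `i > n`. -/
theorem exists_seq_of_not_isRelativelyCompact [T2Space G] (c : G → G → G) {V W K T L : Set G}
    (hK : IsCompact K) (hVK : V ⊆ K) (hWK : W ⊆ K)
    (hc1 : ∀ x C, IsCompact C → IsCompact {l | c l x ∈ C})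
    (hc2 : ∀ l C, IsCompact C → IsCompact {x | c l x ∈ C})
    (hL : ¬ IsRelativelyCompact L)
    (hLI : ∀ I ⊆ L, I.Finite → ¬ IsRelativelyCompact {x | ∀ b ∈ I, c b x ∈ V * T}) :
    ∃ T₁ ⊆ T, ∃ l x : ℕ → G, (∀ i n, i ≤ n → c (l i) (x n) ∈ V * T₁) ∧
      ∀ j k, j < k → c (l k) (x j) ∉ W * T₁ := by
  classical
  have hτ : ∀ y, ∃ t, y ∈ V * T → t ∈ T ∧ y * t⁻¹ ∈ V := by
    intro y
    by_cases hy : y ∈ V * T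
    · obtain ⟨v, hv, t, ht, rfl⟩ := hy
      exact ⟨t, fun _ => ⟨ht, by simpa using hv⟩⟩
    · exact ⟨1, fun h => absurd h hy⟩
  choose τ hτ using hτ
  -- At each stage `l` is chosen before `x`. A bad `x` has `c q x = v τ` and `c p a.2 = w τ`, so `c
  -- q x ∈ K * K⁻¹ * {c p a.2}`; thus bad choices of `l` and of `x` each lie in a compact set.
  obtain ⟨f, hf⟩ := exists_seq_finset_image (fun (S : Finset (L × G)) y =>
    (∀ a ∈ S, ∀ b ∈ S, ∀ d ∈ S, c y.1 a.2 * (τ (c b.1 d.2))⁻¹ ∉ W) ∧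
    (∀ q ∈ insert y.1 (S.image Prod.fst), c q y.2 ∈ V * T) ∧
    ∀ q ∈ insert y.1 (S.image Prod.fst), ∀ p ∈ insert y.1 (S.image Prod.fst), ∀ a ∈ S,
      c p a.2 * (τ (c q y.2))⁻¹ ∉ W) (by
    intro S
    have hC₁ : IsCompact (⋃ a ∈ S, ⋃ b ∈ S, ⋃ d ∈ S, {l | c l a.2 ∈ K * {τ (c b.1 d.2)}}) := by
      refine S.isCompact_biUnion fun a _ => ?_
      refine S.isCompact_biUnion fun b _ => ?_
      exact S.isCompact_biUnion fun d _ => hc1 _ _ (hK.mul isCompact_singleton)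
    obtain ⟨l, hl, hlC⟩ := exists_mem_notMem_of_not_isRelativelyCompact hL hC₁
    let P : Finset L := insert ⟨l, hl⟩ (S.image Prod.fst)
    have hC₂ : IsCompact (⋃ q ∈ P, ⋃ p ∈ P, ⋃ a ∈ S, {x | c q x ∈ K * K⁻¹ * {c p a.2}}) := by
      refine P.isCompact_biUnion fun q _ => ?_
      refine P.isCompact_biUnion fun p _ => ?_
      exact S.isCompact_biUnion fun a _ => hc2 _ _ ((hK.mul hK.inv).mul isCompact_singleton)
    have hP : ¬ IsRelativelyCompact {x | ∀ b ∈ (Subtype.val '' (P : Set L)), c b x ∈ V * T} :=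
      hLI _ (by rintro _ ⟨q, -, rfl⟩; exact q.2) (P.finite_toSet.image _)
    obtain ⟨x, hx, hxC⟩ := exists_mem_notMem_of_not_isRelativelyCompact hP hC₂
    have hxP : ∀ q ∈ P, c q x ∈ V * T := fun q hq =>
      hx q (mem_image_of_mem _ hq)
    refine ⟨(⟨l, hl⟩, x), fun a ha b hb d hd hW => hlC ?_, hxP, fun q hq p hp a ha hW => hxC ?_⟩
    · simp only [mem_iUnion]
      exact ⟨a, ha, b, hb, d, hd, mem_mul_singleton_iff.2 (hWK hW)⟩
    · simp only [mem_iUnion]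
      refine ⟨q, hq, p, hp, a, ha, mem_mul_singleton_iff.2 ?_⟩
      refine ⟨_, hVK (hτ _ (hxP q hq)).2, _, inv_mem_inv.2 (hWK hW), ?_⟩
      simp [mul_assoc])
  have hlt : ∀ i j, i < j → f i ∈ (Finset.range j).image f := fun i j hij =>
    Finset.mem_image_of_mem _ (Finset.mem_range.2 hij)
  have hle : ∀ i j, i ≤ j → (f i).1 ∈ insert (f j).1 (((Finset.range j).image f).image Prod.fst) := by
    intro i j hij
    rcases hij.lt_or_eq with h | rfl
    · exact Finset.mem_insert_of_mem (Finset.mem_image_of_mem _ (hlt i j h))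
    · exact Finset.mem_insert_self _ _
  have hVT : ∀ i n, i ≤ n → c (f i).1 (f n).2 ∈ V * T := fun i n h => (hf n).2.1 _ (hle i n h)
  refine ⟨{t | ∃ i n, i ≤ n ∧ t = τ (c (f i).1 (f n).2)}, ?_, fun n => (f n).1, fun n => (f n).2,
    fun i n h => ?_, fun j k hjk => ?_⟩
  · rintro _ ⟨i, n, h, rfl⟩
    exact (hτ _ (hVT i n h)).1
  · exact ⟨_, (hτ _ (hVT i n h)).2, _, ⟨i, n, h, rfl⟩, by simp⟩
  · rintro ⟨w, hw, _, ⟨i, n, h, rfl⟩, hwt⟩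
    have hmem : c (f k).1 (f j).2 * (τ (c (f i).1 (f n).2))⁻¹ ∈ W := by
      rw [← hwt]; simpa using hw
    -- If `n < k`, the choice of `l k` avoided the coincidence; if `k ≤ n`, the choice of `x n` did,
    -- as `j < n`.
    rcases lt_or_ge n k with hnk | hkn
    · exact (hf k).1 _ (hlt j k hjk) _ (hlt i k (h.trans_lt hnk)) _ (hlt n k hnk) hmem
    · exact (hf n).2.2 _ (hle i n h) _ (hle k n hkn) _ (hlt j n (hjk.trans_le hkn)) hmem

/-- Failure produces a triangular array of values 1 and 0, contradicting the double limit property.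
The left version exchanges the two sequences. -/
theorem isTranslationCompact_of_approximable [T2Space G] {V W K T : Set G}
    (hK : IsCompact K) (hVK : V ⊆ K) (hWK : W ⊆ K)
    (hT : ∀ T₁ ⊆ T, ∃ h ∈ WAP G, (∀ x ∈ V * T₁, h x = 1) ∧ ∀ x, x ∉ W * T₁ → h x = 0) :
    IsTranslationCompact (V * T) := by
  have hl : ∀ x C, IsCompact C → IsCompact {l : G | l * x ∈ C} := fun x C hC =>
    (Homeomorph.mulRight x).isCompact_preimage.2 hC
  have hr : ∀ l C, IsCompact C → IsCompact {x : G | l * x ∈ C} := fun l C hC =>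
    (Homeomorph.mulLeft l).isCompact_preimage.2 hC
  constructor
  · intro L hL
    by_contra! hcon
    obtain ⟨T₁, hT₁, l, x, h1, h0⟩ := exists_seq_of_not_isRelativelyCompact (fun l x => l * x)
      (T := T) hK hVK hWK hl hr hL (by
        intro I hI hfin
        convert hcon I hI hfin using 2
        ext x
        simp only [mem_ofPred_eq, mem_iInter, mem_singleton_inv_mul_iff])
    obtain ⟨h, hh, hh1, hh0⟩ := hT T₁ hT₁
    refine one_ne_zero (eq_of_mem_WAP_of_tendsto hh (s := l) (x := x) (a := 1) (b := 0) ?_ ?_)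
    · intro n
      refine tendsto_const_nhds.congr' ?_
      filter_upwards [eventually_ge_atTop n] with m hm
      exact (hh1 _ (h1 n m hm)).symm
    · intro m
      refine tendsto_const_nhds.congr' ?_
      filter_upwards [eventually_gt_atTop m] with n hn
      exact (hh0 _ (h0 m n hn)).symm
  · intro L hL
    by_contra! hcon
    obtain ⟨T₁, hT₁, l, x, h1, h0⟩ := exists_seq_of_not_isRelativelyCompact (fun l x => x * l)
      (T := T) hK hVK hWK hr hl hL (by
        intro I hI hfin
        convert hcon I hI hfin using 2
        ext x
        simp only [mem_ofPred_eq, mem_iInter, mem_mul_singleton_inv_iff])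
    obtain ⟨h, hh, hh1, hh0⟩ := hT T₁ hT₁
    refine zero_ne_one (eq_of_mem_WAP_of_tendsto hh (s := x) (x := l) (a := 0) (b := 1) ?_ ?_)
    · intro n
      refine tendsto_const_nhds.congr' ?_
      filter_upwards [eventually_gt_atTop n] with m hm
      exact (hh0 _ (h0 n m hm)).symm
    · intro m
      refine tendsto_const_nhds.congr' ?_
      filter_upwards [eventually_ge_atTop m] with n hn
      exact (hh1 _ (h1 m n hn)).symm

end WeaklyAlmostPeriodic

theorem mainTheorem6 {G : Type*} [Group G] [TopologicalSpace G] [IsTopologicalGroup G]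
    [LocallyCompactSpace G] [TopologicalSpace.MetrizableSpace G]
    (hG : IsEGroup G) (T : Set G) (hT : IsESet T) :
    IsApproximableInterpolationSet (WAP G) T ↔
      ∃ V ∈ 𝓝 (1 : G), IsRightUniformlyDiscreteWrt V T ∧ IsTranslationCompact (V * T) := by
  constructor
  · rintro ⟨hint, happ⟩
    obtain ⟨D, hD, hDT⟩ := hint.exists_isRightUniformlyDiscreteWrt
    obtain ⟨K, hK, hK1⟩ := exists_compact_mem_nhds (1 : G)
    obtain ⟨V₁, V₂, ho1, h1, -, -, hcl, hsub, H⟩ := happ K hK1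
    -- `V₁` brings approximation inside the compact `K`, and `D` brings discreteness; both
    -- properties pass to smaller neighbourhoods.
    refine ⟨V₁ ∩ D, inter_mem (ho1.mem_nhds h1) hD, fun s hs s' hs' hne => ?_, ?_⟩
    · refine subset_eq_empty ?_ (hDT s hs s' hs' hne)
      exact inter_subset_inter (mul_subset_mul_right inter_subset_right)
        (mul_subset_mul_right inter_subset_right)
    · refine isTranslationCompact_of_approximable hK
        (inter_subset_left.trans (subset_closure.trans (hcl.trans hsub))) hsub fun T₁ hT₁ => ?_
      obtain ⟨h, hh, hh1, hh0⟩ := H T₁ hT₁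
      exact ⟨h, hh, fun x hx => hh1 x (mul_subset_mul_right inter_subset_left hx), hh0⟩
  · rintro ⟨V, hV, hd, hc⟩
    exact isApproximableInterpolationSet_WAP hT.2 hV hd hc
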